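/- Let $C\subseteq\{0,1\}^X$ be a concept class over a finite domain $X$. A labeled sample is a finite set $S\subseteq X\times\{0,1\}$ of size $|S|$; a concept $c\in C$ is consistent with $S$ if $c(x)=b$ for all $(x,b)\in S$, and $S$ is $C$-realizable if some $c\in C$ is consistent with it. A $C$-saturating matching is an injective map $M$ assigning to each $c\in C$ a labeled sample $M(c)$ with which $c$ is consistent; its cost is $\max_{c\in C}|M(c)|$. It is greedy if no $C$-saturating matching $M'$ differs from $M$ on exactly one concept $c$ and satisfies $|M'(c)|<|M(c)|$; it has the antichain property if $M(c)\not\subseteq M(c')$ for all $c\neq c'$ in $C$. Define the following parameters. - $\mathrm{SMN}(C)$: the smallest cost of a $C$-saturating matching. - $\mathrm{SMN}'(C)$: the smallest $d$ such that at least $|C|$ labeled samples of size at most $d$ are $C$-realizable. - $\mathrm{AMN}(C)$: the smallest cost of a $C$-saturating matching with the antichain property. - $\mathrm{AMN}'(C)$: the smallest $d$ such that the $C$-realizable samples of size at most $d$ contain an antichain (with respect to inclusion) of size $|C|$. - $\mathrm{GMN}(C)$: the largest cost of a greedy $C$-saturating matching. - $\mathrm{GMN}'(C)$: the smallest $d$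 such that $\sum_{i=0}^{d}\binom{|X|}{i}\ge|C|$. - $\mathrm{VCD}(C)$: the VC-dimension, i.e. the largest size of a set $T\subseteq X$ all of whose $2^{|T|}$ labelings are $C$-realizable. - $\mathrm{RTD}(C)$: the recursive teaching dimension, i.e. the smallest $d$ for which there are an enumeration $c_1,\dots,c_N$ of $C$ (without repetition) and labeled samples $S_1,\dots,S_N$ of size at most $d$ such that, for each $t$, $c_t$ is the only concept among $c_t,c_{t+1},\dots,c_N$ that is consistent with $S_t$. - $\mathrm{STD}_{\min}(C)$: a subset teaching sequence is a sequence $(M_k)_{k\ge0}$ of $C$-saturating matchings such that $M_0(c)=\{(x,c(x)):x\in X\}$, $M_{k+1}(c)\subseteq M_k(c)$ and $M_{k+1}(c)\not\subseteq M_k(c')$ for all $k\ge 0$ and all $c\ne c'$ in $C$ (the first two conditions for all $c\in C$). Such a sequence is eventually constant; its cost is the cost of its eventual matching, and $\mathrm{STD}_{\min}(C)$ is the smallest cost of a subset teaching sequence for $C$. For the empty class all maxima over the empty set are read as $0$. Then for every concept class $C$ over a finite domain: 1. $\mathrm{SMN}'(C)\le\mathrm{SMN}(C)$, 2. $\mathrm{SMN}(C)\le\mathrm{GMN}(C)$,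 3. $\mathrm{GMN}(C)\le\mathrm{GMN}'(C)$, 4. $\mathrm{GMN}'(C)\le\min\{\mathrm{VCD}(C),\mathrm{RTD}(C)\}$, 5. $\mathrm{SMN}'(C)\le\mathrm{AMN}'(C)$, 6. $\mathrm{AMN}'(C)\le\mathrm{AMN}(C)$, 7. $\mathrm{AMN}(C)\le\mathrm{STD}_{\min}(C)$, 8. $\mathrm{STD}_{\min}(C)\le\min\{\mathrm{VCD}(C),\mathrm{RTD}(C)\}$, 9. $\mathrm{SMN}(C)\le\mathrm{AMN}(C)$, 10. $\mathrm{AMN}'(C)\le\mathrm{GMN}'(C)$. Moreover, each of these ten inequalities is occasionally strict: for each of them there is a concept class over a finite domain for which it holds with $<$. -/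

import Mathlib

open Finset

namespace ConceptClass

universe u

/-- A concept over the domain `X` is a function from `X` to `{0, 1}` (`false = 0`, `true = 1`).
A concept class over a finite domain `X` is a term of `Finset (Concept X)`. -/
abbrev Concept (X : Type u) : Type u := X → Bool

/-- A labeled sample over `X`: a finite set of pairs `(x, b)` with `x ∈ X`, `b ∈ {0, 1}`. -/
abbrev Sample (X : Type u) : Type u := Finset (X × Bool)

variable {X : Type u}

/-- The concept `c` is consistent with the sample `S`. -/
def Consistent (c : Concept X) (S : Sample X) : Prop := ∀ p ∈ S, c p.1 = p.2

instance (c : Concept X) (S : Sample X) : Decidable (Consistent c S) :=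
  inferInstanceAs (Decidable (∀ p ∈ S, c p.1 = p.2))

/-- The sample `S` is realizable by `C`. -/
def Realizable (C : Finset (Concept X)) (S : Sample X) : Prop := ∃ c ∈ C, Consistent c S

instance (C : Finset (Concept X)) (S : Sample X) : Decidable (Realizable C S) :=
  inferInstanceAs (Decidable (∃ c ∈ C, Consistent c S))

/-- `M` is a `C`-saturating matching: `M c` is a sample with which `c` is consistent, and distinct
concepts obtain distinct samples. -/
def IsSaturatingMatching (C : Finset (Concept X)) (M : C → Sample X) : Prop :=
  (∀ c : C, Consistent (c : Concept X) (M c)) ∧ Function.Injective M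

/-- The cost of `M`: the size of the largest sample that is assigned by `M`
(`0` for the empty class). -/
def cost (C : Finset (Concept X)) (M : C → Sample X) : ℕ := Finset.univ.sup fun c => #(M c)

/-- `M'` is a direct improvement of `M`: a `C`-saturating matching that differs from `M` only on
a single concept, to which it assigns a smaller sample. -/
def IsDirectImprovement (C : Finset (Concept X)) (M' M : C → Sample X) : Prop :=
  IsSaturatingMatching C M' ∧ ∃ c : C, (∀ c' : C, c' ≠ c → M' c' = M c') ∧ #(M' c) < #(M c)

/-- A greedy `C`-saturating matching is one without direct improvements. -/
def IsGreedyMatching (C : Finset (Concept X)) (M : C → Sample X) : Prop :=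
  IsSaturatingMatching C M ∧ ∀ M' : C → Sample X, ¬ IsDirectImprovement C M' M

/-- No sample assigned by `M` is contained in the sample assigned to another concept. -/
def HasAntichainProperty (C : Finset (Concept X)) (M : C → Sample X) : Prop :=
  ∀ c c' : C, c ≠ c' → ¬ M c ⊆ M c'

/-- The saturating matching number. -/
noncomputable def SMN (C : Finset (Concept X)) : ℕ :=
  sInf {d | ∃ M : C → Sample X, IsSaturatingMatching C M ∧ cost C M = d}

/-- The antichain matching number. -/
noncomputable def AMN (C : Finset (Concept X)) : ℕ :=
  sInf {d | ∃ M : C → Sample X,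
    IsSaturatingMatching C M ∧ HasAntichainProperty C M ∧ cost C M = d}

/-- The largest cost of a greedy `C`-saturating matching (the set is bounded, since no sample
that is consistent with a concept has more than `|X|` elements). -/
noncomputable def GMN (C : Finset (Concept X)) : ℕ :=
  sSup {d | ∃ M : C → Sample X, IsGreedyMatching C M ∧ cost C M = d}

/-- A teaching plan for `C`: an enumeration `e` of all concepts in `C`, together with samples `S`
such that `S t` is a teaching set for `e t` in the class of the concepts `e s` with `s ≥ t`: of
these, `e t` is the only one that is consistent with `S t`. -/
def IsTeachingPlan (C : Finset (Concept X)) (e : Fin #C ≃ C) (S : Fin #C → Sample X) : Prop :=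
  ∀ t, Consistent (e t : Concept X) (S t) ∧
    ∀ s, t < s → ¬ Consistent (e s : Concept X) (S t)

/-- The recursive teaching dimension: the smallest order of a teaching plan, the order being the
size of the largest sample in the plan. -/
noncomputable def RTD (C : Finset (Concept X)) : ℕ :=
  sInf {d | ∃ (e : Fin #C ≃ C) (S : Fin #C → Sample X),
    IsTeachingPlan C e S ∧ (Finset.univ.sup fun t => #(S t)) = d}

/-- The smallest `k` from which on the sequence `M` is constant. -/
noncomputable def stabilizationIndex (C : Finset (Concept X)) (M : ℕ → C → Sample X) : ℕ :=
  sInf {k | ∀ k', k ≤ k' → ∀ c : C, M k' c = M k c}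

variable [Fintype X]

/-- `GMN'`: the smallest `d` such that `∑_{i ≤ d} (|X| choose i) ≥ |C|`. -/
noncomputable def GMN' (C : Finset (Concept X)) : ℕ :=
  sInf {d | #C ≤ ∑ i ∈ Finset.range (d + 1), (Fintype.card X).choose i}

variable [DecidableEq X]

/-- The set of the `C`-realizable samples of size at most `d`. -/
def realizableSamples (C : Finset (Concept X)) (d : ℕ) : Finset (Sample X) :=
  Finset.univ.filter fun S => Realizable C S ∧ #S ≤ d

/-- `SMN'`: the smallest `d` such that the number of `C`-realizable samples of size at most `d`
is at least `|C|`. -/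
noncomputable def SMN' (C : Finset (Concept X)) : ℕ :=
  sInf {d | #C ≤ #(realizableSamples C d)}

/-- `AMN'`: the smallest `d` such that the `C`-realizable samples of size at most `d` contain an
antichain (for inclusion) of size `|C|`. -/
noncomputable def AMN' (C : Finset (Concept X)) : ℕ :=
  sInf {d | ∃ A : Finset (Sample X), A ⊆ realizableSamples C d ∧ #A = #C ∧
    IsAntichain (· ⊆ ·) (A : Set (Sample X))}

/-- The family of the sets `{x | c x = 1}` with `c ∈ C`. -/
def supports (C : Finset (Concept X)) : Finset (Finset X) :=
  C.image fun c => Finset.univ.filter fun x => c x = true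

/-- The VC-dimension (`0` for the empty class). -/
def VCD (C : Finset (Concept X)) : ℕ := (supports C).vcDim

/-- Shattering, as used by `VCD`, means that every labeling of `T` is a `C`-realizable sample. -/
theorem shatters_supports_iff (C : Finset (Concept X)) (T : Finset X) :
    (supports C).Shatters T ↔
      ∀ b : X → Bool, Realizable C (T.image fun x => (x, b x)) := by
  constructor
  · intro h b
    obtain ⟨u, hu, hTu⟩ := h (Finset.filter_subset (fun x => b x = true) T)
    obtain ⟨c, hc, rfl⟩ := Finset.mem_image.1 hu
    refine ⟨c, hc, fun p hp => ?_⟩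
    obtain ⟨x, hx, rfl⟩ := Finset.mem_image.1 hp
    have := Finset.ext_iff.1 hTu x
    simp only [Finset.mem_inter, Finset.mem_filter, Finset.mem_univ, true_and, hx] at this
    exact Bool.eq_iff_iff.2 this
  · intro h t ht
    obtain ⟨c, hc, hcons⟩ := h fun x => decide (x ∈ t)
    refine ⟨_, Finset.mem_image_of_mem _ hc, ?_⟩
    ext x
    simp only [Finset.mem_inter, Finset.mem_filter, Finset.mem_univ, true_and]
    constructor
    · rintro ⟨hx, hcx⟩
      have := hcons _ (Finset.mem_image_of_mem _ hx)
      simpa [hcx] using this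
    · intro hx
      have := hcons _ (Finset.mem_image_of_mem _ (ht hx))
      exact ⟨ht hx, by simpa [hx] using this⟩

/-- The sample `{(x, c x) | x ∈ X}`. -/
def fullSample (c : Concept X) : Sample X := Finset.univ.image fun x => (x, c x)

/-- A subset teaching sequence for `C`. -/
def IsSubsetTeachingSequence (C : Finset (Concept X)) (M : ℕ → C → Sample X) : Prop :=
  (∀ k, IsSaturatingMatching C (M k)) ∧
  (∀ c : C, M 0 c = fullSample (c : Concept X)) ∧
  (∀ k, ∀ c : C, M (k + 1) c ⊆ M k c) ∧
  (∀ k, ∀ c c' : C, c' ≠ c → ¬ M (k + 1) c ⊆ M k c')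

/-- The smallest cost of a subset teaching sequence, the cost of a sequence being the cost of the
matching at which it becomes stationary. -/
noncomputable def STDmin (C : Finset (Concept X)) : ℕ :=
  sInf {d | ∃ M : ℕ → C → Sample X,
    IsSubsetTeachingSequence C M ∧ cost C (M (stabilizationIndex C M)) = d}

end ConceptClass

open ConceptClass

/-!
Most of the ten inequalities are immediate: a matching yields as many realizable samples as there
are concepts, a matching of least total size is greedy, and a subset teaching sequence becomes
stationary at a matching with the antichain property. The others rest on the following ideas.

* `GMN ≤ GMN'`. In a greedy matching, all samples consistent with `c` that are smaller than `M c`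
  are occupied by other concepts (`IsGreedyMatching.exists_eq`), and there is one such sample for
  each set of fewer than `|M c|` points.
* `GMN' ≤ VCD` is the Sauer-Shelah lemma. For `GMN' ≤ RTD`, the samples of a teaching plan of order
  `d` have indicator functions that are polynomials of degree at most `d` and form a triangular
  system, so that all functions on `C` are spanned by the monomials of degree at most `d`.
* `STDmin ≤ RTD`. Once the samples of a teaching plan are enlarged to the same size, they are
  incomparable, and they can replace the full samples one by one in the order of the plan.
* `STDmin ≤ VCD`. The points of the domain are processed one after the other, each being removed
  from the sample of every concept for which this is a legal reduction. The points that remain in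
  the sample of a concept are shattered (`exists_eq_on_removePoints`): that a point could not be
  removed is witnessed by a concept that differs at this point and agrees on all later ones.
* `AMN' ≤ GMN'`. A class has at least `min |C| (∑ i ≤ d, n.choose i)` realizable samples of size
  exactly `d ≤ n` (`min_le_card_samplesOn`). This is proved by induction on the number of points:
  either some point splits the class such that Pascal's rule applies, or all fibers are large and
  double counting of the pairs of a sample and one of its elements suffices.

The strict inequalities are witnessed by six small classes: the square `{0, 1}²`, on which
`AMN = 1` although no full sample can ever be reduced; the square with an additional constant
coordinate; the concepts of even parity on three points; the cube `{0, 1}³` without one concept;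
the cube `{0, 1}³` with the first coordinate repeated four times; and `{0, 1}⁴`, extended by five
zero coordinates, together with the concept that is constantly `1`.
-/

namespace ConceptClass

universe u

/-! ### Samples as restrictions of concepts -/

section Samples

variable {X : Type u} [DecidableEq X]

/-- The sample that consists of the values of the concept `c` on the set `T`. -/
def restrict (c : Concept X) (T : Finset X) : Sample X := T.image fun x => (x, c x)

theorem mem_restrict {c : Concept X} {T : Finset X} {p : X × Bool} :
    p ∈ restrict c T ↔ p.1 ∈ T ∧ c p.1 = p.2 := by
  simp only [restrict, mem_image]
  constructor
  · rintro ⟨x, hx, rfl⟩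
    exact ⟨hx, rfl⟩
  · rintro ⟨hx, h⟩
    exact ⟨p.1, hx, Prod.ext rfl h⟩

theorem card_restrict (c : Concept X) (T : Finset X) : #(restrict c T) = #T :=
  card_image_of_injective _ fun _ _ h => (Prod.ext_iff.1 h).1

theorem consistent_restrict (c : Concept X) (T : Finset X) : Consistent c (restrict c T) :=
  fun _ hp => (mem_restrict.1 hp).2

theorem restrict_subset_restrict {c c' : Concept X} {T T' : Finset X} :
    restrict c T ⊆ restrict c' T' ↔ T ⊆ T' ∧ ∀ x ∈ T, c' x = c x := by
  constructor
  · intro h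
    have h' : ∀ x ∈ T, x ∈ T' ∧ c' x = c x := fun x hx => by
      simpa [mem_restrict] using h (show (x, c x) ∈ restrict c T from mem_restrict.2 ⟨hx, rfl⟩)
    exact ⟨fun x hx => (h' x hx).1, fun x hx => (h' x hx).2⟩
  · rintro ⟨h1, h2⟩ p hp
    obtain ⟨hx, h⟩ := mem_restrict.1 hp
    exact mem_restrict.2 ⟨h1 hx, (h2 _ hx).trans h⟩

omit [DecidableEq X] in
theorem Consistent.mono {c : Concept X} {S S' : Sample X} (h : Consistent c S') (hS : S ⊆ S') :
    Consistent c S := fun p hp => h p (hS hp)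

theorem restrict_injective (c : Concept X) : Function.Injective (restrict c) := fun _ _ h =>
  Subset.antisymm (restrict_subset_restrict.1 h.subset).1
    (restrict_subset_restrict.1 h.symm.subset).1

variable [Fintype X]

theorem fullSample_eq_restrict (c : Concept X) : fullSample c = restrict c univ := rfl

theorem consistent_iff_subset_fullSample {c : Concept X} {S : Sample X} :
    Consistent c S ↔ S ⊆ fullSample c := by
  rw [fullSample_eq_restrict]
  exact ⟨fun h p hp => mem_restrict.2 ⟨mem_univ _, h p hp⟩,
    fun h p hp => (mem_restrict.1 (h hp)).2⟩

theorem Consistent.card_le {c : Concept X} {S : Sample X} (h : Consistent c S) :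
    #S ≤ Fintype.card X := by
  simpa [fullSample_eq_restrict, card_restrict] using
    card_le_card (consistent_iff_subset_fullSample.1 h)

theorem eq_of_fullSample_subset {c c' : Concept X} (h : fullSample c ⊆ fullSample c') :
    c = c' :=
  funext fun x => ((restrict_subset_restrict.1 h).2 x (mem_univ x)).symm

/-- A sample that is consistent with a concept extends to such a sample of any prescribed size
between its own and the size of the domain. -/
theorem Consistent.exists_superset {c : Concept X} {S : Sample X} (h : Consistent c S) {d : ℕ}
    (hS : #S ≤ d) (hd : d ≤ Fintype.card X) :
    ∃ S', S ⊆ S' ∧ Consistent c S' ∧ #S' = d := by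
  obtain ⟨S', h1, h2, h3⟩ := exists_subsuperset_card_eq (consistent_iff_subset_fullSample.1 h) hS
    (by simpa [fullSample_eq_restrict, card_restrict] using hd)
  exact ⟨S', h1, consistent_iff_subset_fullSample.2 h2, h3⟩

end Samples

/-! ### Matchings and the elementary inequalities -/

section Matchings

variable {X : Type u} {C : Finset (Concept X)}

theorem cost_le_iff {M : C → Sample X} {d : ℕ} : cost C M ≤ d ↔ ∀ c, #(M c) ≤ d := by
  simp [cost]

variable [DecidableEq X] [Fintype X]

theorem isSaturatingMatching_fullSample (C : Finset (Concept X)) :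
    IsSaturatingMatching C fun c => fullSample (c : Concept X) :=
  ⟨fun _ => consistent_restrict _ _,
    fun _ _ h => Subtype.ext (eq_of_fullSample_subset (h : fullSample _ = fullSample _).subset)⟩

theorem hasAntichainProperty_fullSample (C : Finset (Concept X)) :
    HasAntichainProperty C fun c => fullSample (c : Concept X) :=
  fun _ _ hne h => hne (Subtype.ext (eq_of_fullSample_subset h))

theorem exists_cost_eq_SMN (C : Finset (Concept X)) :
    ∃ M : C → Sample X, IsSaturatingMatching C M ∧ cost C M = SMN C :=
  Nat.sInf_mem (s := {d | ∃ M : C → Sample X, IsSaturatingMatching C M ∧ cost C M = d})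
    ⟨_, _, isSaturatingMatching_fullSample C, rfl⟩

omit [DecidableEq X] [Fintype X] in
theorem SMN_le {M : C → Sample X} (hM : IsSaturatingMatching C M) {d : ℕ}
    (hd : ∀ c, #(M c) ≤ d) : SMN C ≤ d :=
  le_trans (Nat.sInf_le (show cost C M ∈ _ from ⟨M, hM, rfl⟩)) (cost_le_iff.2 hd)

theorem exists_cost_eq_AMN (C : Finset (Concept X)) :
    ∃ M : C → Sample X, IsSaturatingMatching C M ∧ HasAntichainProperty C M ∧ cost C M = AMN C :=
  Nat.sInf_mem (s := {d | ∃ M : C → Sample X,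
      IsSaturatingMatching C M ∧ HasAntichainProperty C M ∧ cost C M = d})
    ⟨_, _, isSaturatingMatching_fullSample C, hasAntichainProperty_fullSample C, rfl⟩

omit [DecidableEq X] [Fintype X] in
theorem AMN_le {M : C → Sample X} (hM : IsSaturatingMatching C M)
    (hA : HasAntichainProperty C M) {d : ℕ} (hd : ∀ c, #(M c) ≤ d) : AMN C ≤ d :=
  le_trans (Nat.sInf_le (show cost C M ∈ _ from ⟨M, hM, hA, rfl⟩)) (cost_le_iff.2 hd)

theorem cost_le_card {M : C → Sample X} (hM : IsSaturatingMatching C M) :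
    cost C M ≤ Fintype.card X :=
  cost_le_iff.2 fun c => (hM.1 c).card_le

theorem bddAbove_cost_greedy (C : Finset (Concept X)) :
    BddAbove {d | ∃ M : C → Sample X, IsGreedyMatching C M ∧ cost C M = d} := by
  refine ⟨Fintype.card X, ?_⟩
  rintro d ⟨M, hM, rfl⟩
  exact cost_le_card hM.1

theorem cost_le_GMN {M : C → Sample X} (hM : IsGreedyMatching C M) : cost C M ≤ GMN C :=
  le_csSup (bddAbove_cost_greedy C) ⟨M, hM, rfl⟩

omit [Fintype X] in
theorem HasAntichainProperty.isAntichain_image {M : C → Sample X}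
    (hA : HasAntichainProperty C M) :
    IsAntichain (· ⊆ ·) ((univ.image M : Finset (Sample X)) : Set (Sample X)) := by
  intro S hS S' hS' hne
  obtain ⟨c, -, rfl⟩ := mem_image.1 hS
  obtain ⟨c', -, rfl⟩ := mem_image.1 hS'
  exact hA c c' fun h => hne (congrArg M h)

omit [DecidableEq X] in
theorem mem_realizableSamples {d : ℕ} {S : Sample X} :
    S ∈ realizableSamples C d ↔ Realizable C S ∧ #S ≤ d := by
  simp [realizableSamples]

/-- A matching of cost at most `d` selects `|C|` realizable samples of size at most `d`. -/
theorem IsSaturatingMatching.image_subset {M : C → Sample X} (hM : IsSaturatingMatching C M)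
    {d : ℕ} (hd : cost C M ≤ d) :
    univ.image M ⊆ realizableSamples C d ∧ #(univ.image M) = #C := by
  refine ⟨fun S hS => ?_, by rw [card_image_of_injective _ hM.2, card_univ, Fintype.card_coe]⟩
  obtain ⟨c, -, rfl⟩ := mem_image.1 hS
  exact mem_realizableSamples.2 ⟨⟨c, c.2, hM.1 c⟩, cost_le_iff.1 hd c⟩

theorem SMN'_le_SMN (C : Finset (Concept X)) : SMN' C ≤ SMN C := by
  obtain ⟨M, hM, hc⟩ := exists_cost_eq_SMN C
  obtain ⟨h1, h2⟩ := hM.image_subset hc.le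
  exact Nat.sInf_le (h2.symm.le.trans (card_le_card h1))

theorem SMN_le_AMN (C : Finset (Concept X)) : SMN C ≤ AMN C := by
  obtain ⟨M, hM, -, hc⟩ := exists_cost_eq_AMN C
  exact SMN_le hM (cost_le_iff.1 hc.le)

theorem AMN'_le_AMN (C : Finset (Concept X)) : AMN' C ≤ AMN C := by
  obtain ⟨M, hM, hA, hc⟩ := exists_cost_eq_AMN C
  obtain ⟨h1, h2⟩ := hM.image_subset hc.le
  exact Nat.sInf_le ⟨_, h1, h2, hA.isAntichain_image⟩

theorem exists_antichain_AMN' (C : Finset (Concept X)) :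
    ∃ A : Finset (Sample X), A ⊆ realizableSamples C (AMN' C) ∧ #A = #C ∧
      IsAntichain (· ⊆ ·) (A : Set (Sample X)) := by
  suffices h : {d | ∃ A : Finset (Sample X), A ⊆ realizableSamples C d ∧ #A = #C ∧
      IsAntichain (· ⊆ ·) (A : Set (Sample X))}.Nonempty from Nat.sInf_mem h
  obtain ⟨h1, h2⟩ := (isSaturatingMatching_fullSample C).image_subset
    (cost_le_card (isSaturatingMatching_fullSample C))
  exact ⟨_, _, h1, h2, (hasAntichainProperty_fullSample C).isAntichain_image⟩

theorem SMN'_le_AMN' (C : Finset (Concept X)) : SMN' C ≤ AMN' C := by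
  obtain ⟨A, h1, h2, -⟩ := exists_antichain_AMN' C
  exact Nat.sInf_le (h2.symm.le.trans (card_le_card h1))

/-- A saturating matching of minimal total size has no direct improvements. -/
theorem exists_isGreedyMatching (C : Finset (Concept X)) :
    ∃ M : C → Sample X, IsGreedyMatching C M := by
  obtain ⟨M, hM, hmin⟩ :=
    (Set.toFinite {M : C → Sample X | IsSaturatingMatching C M}).exists_minimalFor
      (fun M => ∑ c, #(M c)) _ ⟨_, isSaturatingMatching_fullSample C⟩
  refine ⟨M, hM, ?_⟩
  rintro M' ⟨hM', c, hne, hlt⟩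
  have hsum : ∑ c, #(M' c) < ∑ c, #(M c) := by
    refine sum_lt_sum (fun c' _ => ?_) ⟨c, mem_univ c, hlt⟩
    rcases eq_or_ne c' c with rfl | h
    · exact hlt.le
    · rw [hne c' h]
  exact absurd (hmin hM' hsum.le) (not_le.2 hsum)

theorem SMN_le_GMN (C : Finset (Concept X)) : SMN C ≤ GMN C := by
  obtain ⟨M, hM⟩ := exists_isGreedyMatching C
  exact (SMN_le hM.1 (cost_le_iff.1 le_rfl)).trans (cost_le_GMN hM)

/-- In a greedy matching, every sample that is consistent with `c` and smaller than `M c` is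
occupied by another concept: otherwise it could replace `M c`. -/
theorem IsGreedyMatching.exists_eq {M : C → Sample X} (hM : IsGreedyMatching C M) {c : C}
    {S : Sample X} (hS : Consistent (c : Concept X) S) (hlt : #S < #(M c)) :
    ∃ c', c' ≠ c ∧ M c' = S := by
  by_contra! h
  refine hM.2 (Function.update M c S) ⟨⟨fun c' => ?_, fun c₁ c₂ h12 => ?_⟩, c,
    fun c' hc' => Function.update_of_ne hc' _ _, by simpa using hlt⟩
  · rcases eq_or_ne c' c with hc' | hc'
    · rw [hc']
      simpa using hS
    · simpa [Function.update_of_ne hc'] using hM.1.1 c'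
  · rcases eq_or_ne c₁ c with h1 | h1 <;> rcases eq_or_ne c₂ c with h2 | h2
    · exact h1.trans h2.symm
    · rw [h1, Function.update_self, Function.update_of_ne h2] at h12
      exact absurd h12.symm (h c₂ h2)
    · rw [h2, Function.update_self, Function.update_of_ne h1] at h12
      exact absurd h12 (h c₁ h1)
    · rw [Function.update_of_ne h1, Function.update_of_ne h2] at h12
      exact hM.1.2 h12

end Matchings

/-! ### Sums of binomial coefficients and greedy matchings -/

section Binomial

/-- The number of subsets of size at most `d` of a set of size `n`. -/
def chooseSum (d n : ℕ) : ℕ := ∑ i ∈ range (d + 1), n.choose i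

theorem card_filter_card_le (X : Type*) [Fintype X] [DecidableEq X] (d : ℕ) :
    #(univ.filter fun T : Finset X => #T ≤ d) = chooseSum d (Fintype.card X) := by
  rw [chooseSum, card_eq_sum_card_fiberwise (f := card) (t := range (d + 1))
    (fun T hT => by simpa [Nat.lt_succ_iff] using hT)]
  refine sum_congr rfl fun i hi => ?_
  rw [← card_univ, ← card_powersetCard]
  congr 1
  ext T
  have := Finset.mem_range.1 hi
  simp only [mem_filter, mem_univ, true_and, mem_powersetCard, subset_univ]
  omega

theorem chooseSum_mono {d d' : ℕ} (h : d ≤ d') (n : ℕ) : chooseSum d n ≤ chooseSum d' n :=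
  sum_le_sum_of_subset (range_subset_range.2 (by omega))

theorem chooseSum_self (n : ℕ) : chooseSum n n = 2 ^ n := Nat.sum_range_choose n

theorem chooseSum_succ_succ (d n : ℕ) :
    chooseSum (d + 1) (n + 1) = chooseSum (d + 1) n + chooseSum d n := by
  unfold chooseSum
  rw [sum_range_succ' _ (d + 1), sum_range_succ' (fun i => n.choose i) (d + 1)]
  simp only [Nat.choose_succ_succ', sum_add_distrib, Nat.choose_zero_right]
  omega

theorem choose_le_choose_of_add_le {n a b : ℕ} (hab : a ≤ b) (h : a + b ≤ n) :
    n.choose a ≤ n.choose b := by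
  -- below the middle the binomial coefficients increase; beyond it, `b` is reflected to `n - b`
  have key : ∀ b, a ≤ b → b ≤ n / 2 → n.choose a ≤ n.choose b := by
    intro b hab
    induction b, hab using Nat.le_induction with
    | base => exact fun _ => le_rfl
    | succ b _ ih =>
      exact fun hb => (ih (by omega)).trans (Nat.choose_le_succ_of_lt_half_left (by omega))
  rcases le_or_gt b (n / 2) with hb | hb
  · exact key b hab hb
  · rw [← Nat.choose_symm (show b ≤ n by omega)]
    exact key _ (by omega) (by omega)

/-- On average over the subsets of size at most `d` of a set of size `n ≥ d`, the size is at least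
`d / 2`: the binomial coefficient of `i ≥ d / 2` dominates the one of `d - i`. -/
theorem mul_chooseSum_le_sum_mul_choose {d n : ℕ} (h : d ≤ n) :
    d * chooseSum d n ≤ 2 * ∑ i ∈ range (d + 1), i * n.choose i := by
  unfold chooseSum
  have hrefl : ∑ i ∈ range (d + 1), i * n.choose i =
      ∑ i ∈ range (d + 1), (d - i) * n.choose (d - i) := by
    rw [← sum_range_reflect]
    simp
  have hrefl' : ∑ i ∈ range (d + 1), n.choose i = ∑ i ∈ range (d + 1), n.choose (d - i) := by
    rw [← sum_range_reflect]
    simp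
  suffices d * ∑ i ∈ range (d + 1), n.choose i + d * ∑ i ∈ range (d + 1), n.choose (d - i) ≤
      2 * ∑ i ∈ range (d + 1), i * n.choose i +
      2 * ∑ i ∈ range (d + 1), (d - i) * n.choose (d - i) by
    rw [← hrefl, ← hrefl'] at this
    omega
  simp only [mul_sum, ← sum_add_distrib]
  refine sum_le_sum fun i hi => ?_
  obtain ⟨j, rfl⟩ := Nat.exists_eq_add_of_le (Nat.lt_succ_iff.1 (Finset.mem_range.1 hi))
  rw [Nat.add_sub_cancel_left]
  rcases le_total i j with hij | hij
  · have := choose_le_choose_of_add_le hij h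
    obtain ⟨e, rfl⟩ := Nat.exists_eq_add_of_le hij
    nlinarith
  · have := choose_le_choose_of_add_le (n := n) hij (by omega)
    obtain ⟨e, rfl⟩ := Nat.exists_eq_add_of_le hij
    nlinarith

theorem mul_chooseSum_succ_le {d n : ℕ} (h : d ≤ n) :
    (d + 1) * chooseSum (d + 1) (n + 1) ≤ 2 * ((n + 1) * chooseSum d n) := by
  refine (mul_chooseSum_le_sum_mul_choose (Nat.succ_le_succ h)).trans_eq ?_
  rw [sum_range_succ', chooseSum, mul_sum]
  rw [zero_mul, add_zero]
  congr 1
  exact sum_congr rfl fun i _ => by rw [Nat.add_one_mul_choose_eq, mul_comm]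

variable {X : Type u} [Fintype X]

theorem GMN'_le_iff {C : Finset (Concept X)} {d : ℕ} :
    GMN' C ≤ d ↔ #C ≤ chooseSum d (Fintype.card X) := by
  classical
  constructor
  · intro h
    have hne : {d | #C ≤ chooseSum d (Fintype.card X)}.Nonempty := by
      refine ⟨Fintype.card X, ?_⟩
      have := card_le_univ C
      simpa [chooseSum_self, Fintype.card_pi] using this
    exact (Nat.sInf_mem hne).trans (chooseSum_mono h _)
  · exact fun h => Nat.sInf_le h

theorem GMN'_le_card (C : Finset (Concept X)) : GMN' C ≤ Fintype.card X := by
  classical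
  have := card_le_univ C
  exact GMN'_le_iff.2 (by simpa [chooseSum_self, Fintype.card_pi] using this)

variable [DecidableEq X]

theorem GMN_le_GMN' (C : Finset (Concept X)) : GMN C ≤ GMN' C := by
  obtain ⟨M₀, hM₀⟩ := exists_isGreedyMatching C
  refine csSup_le ⟨_, M₀, hM₀, rfl⟩ ?_
  rintro _ ⟨M, hM, rfl⟩
  refine cost_le_iff.2 fun c => ?_
  by_contra! hlt
  -- every sample `c|T` with `|T| ≤ GMN' C` is assigned to some concept other than `c`
  have : Nonempty C := ⟨c⟩
  choose! f hf using fun (T : Finset X) (hT : #T ≤ GMN' C) =>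
    hM.exists_eq (consistent_restrict (c : Concept X) T)
      (by rw [card_restrict]; exact hT.trans_lt hlt)
  have h1 : #(univ.filter fun T : Finset X => #T ≤ GMN' C) ≤ #((univ : Finset C).erase c) := by
    refine card_le_card_of_injOn f (fun T hT => ?_) fun T hT T' hT' h => ?_
    · have hT : #T ≤ GMN' C := by simpa using hT
      simpa using (hf T hT).1
    · have hT : #T ≤ GMN' C := by simpa using hT
      have hT' : #T' ≤ GMN' C := by simpa using hT'
      exact restrict_injective _ ((hf T hT).2.symm.trans (h ▸ (hf T' hT').2))
  rw [card_filter_card_le, card_erase_of_mem (mem_univ _), card_univ, Fintype.card_coe] at h1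
  have h2 := GMN'_le_iff.1 (le_refl (GMN' C))
  have h3 : 0 < #C := card_pos.2 ⟨_, c.2⟩
  omega

end Binomial

/-! ### Subset teaching sequences -/

section SubsetTeaching

variable {X : Type u} [DecidableEq X] [Fintype X] {C : Finset (Concept X)}

/-- One step of a subset teaching sequence: every sample of `M'` is contained in the sample of `M`
for the same concept, but in no other sample of `M`. -/
def IsReduction (C : Finset (Concept X)) (M M' : C → Sample X) : Prop :=
  (∀ c, M' c ⊆ M c) ∧ ∀ c c', c' ≠ c → ¬ M' c ⊆ M c'

/-- The members of a sequence of reductions that starts with the full samples are automatically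
saturating matchings. -/
theorem isSubsetTeachingSequence_of_isReduction {M : ℕ → C → Sample X}
    (h0 : ∀ c, M 0 c = fullSample (c : Concept X))
    (h : ∀ k, IsReduction C (M k) (M (k + 1))) : IsSubsetTeachingSequence C M := by
  refine ⟨fun k => ⟨fun c => ?_, fun c c' hcc' => ?_⟩, h0, fun k => (h k).1, fun k => (h k).2⟩
  · rw [consistent_iff_subset_fullSample, ← h0]
    induction k with
    | zero => exact Subset.rfl
    | succ k ih => exact ((h k).1 c).trans ih
  · by_contra hne
    cases k with
    | zero => exact hne ((isSaturatingMatching_fullSample C).2 (by simpa only [h0] using hcc'))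
    | succ k => exact (h k).2 c c' (Ne.symm hne) (hcc'.subset.trans ((h k).1 c'))

omit [DecidableEq X] in
theorem exists_stable {M : ℕ → C → Sample X} (h : ∀ k c, M (k + 1) c ⊆ M k c) :
    ∀ k', stabilizationIndex C M ≤ k' → ∀ c, M k' c = M (stabilizationIndex C M) c := by
  suffices hne : {k | ∀ k', k ≤ k' → ∀ c : C, M k' c = M k c}.Nonempty from Nat.sInf_mem hne
  obtain ⟨k, hk⟩ := WellFoundedGT.monotone_chain_condition
    (⟨fun k => OrderDual.toDual (M k), monotone_nat_of_le_succ fun k => h k⟩ :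
      ℕ →o (C → Sample X)ᵒᵈ)
  exact ⟨k, fun k' hk' c => congrFun (hk k' hk').symm c⟩

theorem STDmin_le {M : ℕ → C → Sample X} (hM : IsSubsetTeachingSequence C M) {k d : ℕ}
    (hd : ∀ c, #(M k c) ≤ d) : STDmin C ≤ d := by
  refine le_trans (Nat.sInf_le (show cost C (M (stabilizationIndex C M)) ∈ _ from ⟨M, hM, rfl⟩))
    (cost_le_iff.2 fun c => ?_)
  rw [← exists_stable hM.2.2.1 _ (le_max_left _ k) c]
  exact (card_le_card (antitone_nat_of_succ_le (f := fun k => M k c)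
    (fun k => hM.2.2.1 k c) (le_max_right _ k))).trans (hd c)

theorem STDmin_le_of_reflTransGen {M : C → Sample X}
    (hM : Relation.ReflTransGen (IsReduction C) (fun c : C => fullSample (c : Concept X)) M) {d : ℕ}
    (hd : ∀ c, #(M c) ≤ d) : STDmin C ≤ d := by
  suffices h : ∃ (f : ℕ → C → Sample X) (n : ℕ), (f 0 = fun c : C => fullSample (c : Concept X)) ∧
      (∀ k, IsReduction C (f k) (f (k + 1))) ∧ f n = M by
    obtain ⟨f, n, h0, hf, rfl⟩ := h
    exact STDmin_le (isSubsetTeachingSequence_of_isReduction (congrFun h0) hf) hd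
  clear hd
  induction hM with
  | refl =>
    exact ⟨fun _ c => fullSample (c : Concept X), 0, rfl, fun _ => ⟨fun _ => Subset.rfl,
      fun c c' hne => hasAntichainProperty_fullSample C c c' hne.symm⟩, rfl⟩
  | @tail M M' _ hMM' ih =>
    obtain ⟨f, n, h0, hf, rfl⟩ := ih
    refine ⟨fun k => if k ≤ n then f k else M', n + 1, by simpa using h0, fun k => ?_, by simp⟩
    rcases lt_trichotomy k n with hk | rfl | hk
    · simpa [hk.le, Nat.succ_le_iff.2 hk] using hf k
    · simpa using hMM'
    · have hself : IsReduction C M' M' :=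
        ⟨fun _ => Subset.rfl, fun c c' hne h => hMM'.2 c c' hne (h.trans (hMM'.1 c'))⟩
      simpa only [if_neg hk.not_ge, if_neg (hk.trans (Nat.lt_succ_self k)).not_ge] using hself

theorem exists_sequence_cost_eq_STDmin (C : Finset (Concept X)) :
    ∃ M : ℕ → C → Sample X,
      IsSubsetTeachingSequence C M ∧ cost C (M (stabilizationIndex C M)) = STDmin C := by
  suffices h : {d | ∃ M : ℕ → C → Sample X, IsSubsetTeachingSequence C M ∧
      cost C (M (stabilizationIndex C M)) = d}.Nonempty from Nat.sInf_mem h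
  exact ⟨_, _, isSubsetTeachingSequence_of_isReduction (C := C)
    (M := fun _ c => fullSample (c : Concept X)) (fun _ => rfl) fun _ => ⟨fun _ => Subset.rfl,
      fun c c' hne => hasAntichainProperty_fullSample C c c' hne.symm⟩, rfl⟩

theorem AMN_le_STDmin (C : Finset (Concept X)) : AMN C ≤ STDmin C := by
  obtain ⟨M, hM, hc⟩ := exists_sequence_cost_eq_STDmin C
  refine AMN_le (hM.1 (stabilizationIndex C M)) (fun c c' hne => ?_) (cost_le_iff.1 hc.le)
  have := hM.2.2.2 (stabilizationIndex C M) c c' hne.symm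
  rwa [exists_stable hM.2.2.1 _ (Nat.le_succ _)] at this

end SubsetTeaching

/-! ### Teaching plans -/

section RecursiveTeaching

variable {X : Type u} {C : Finset (Concept X)}

theorem RTD_le {e : Fin #C ≃ C} {S : Fin #C → Sample X} (h : IsTeachingPlan C e S) {d : ℕ}
    (hd : ∀ t, #(S t) ≤ d) : RTD C ≤ d :=
  le_trans (Nat.sInf_le (show (univ.sup fun t => #(S t)) ∈ _ from ⟨e, S, h, rfl⟩))
    (Finset.sup_le fun t _ => hd t)

variable [DecidableEq X] [Fintype X]

theorem exists_isTeachingPlan (C : Finset (Concept X)) :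
    ∃ (e : Fin #C ≃ C) (S : Fin #C → Sample X),
      IsTeachingPlan C e S ∧ ∀ t, #(S t) ≤ RTD C := by
  have hne : {d | ∃ (e : Fin #C ≃ C) (S : Fin #C → Sample X),
      IsTeachingPlan C e S ∧ (univ.sup fun t => #(S t)) = d}.Nonempty := by
    refine ⟨_, C.equivFin.symm, fun t => fullSample (C.equivFin.symm t : Concept X),
      fun t => ⟨consistent_restrict _ _, fun s hts h => hts.ne ?_⟩, rfl⟩
    exact C.equivFin.symm.injective (Subtype.ext
      (eq_of_fullSample_subset (consistent_iff_subset_fullSample.1 h)))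
  obtain ⟨e, S, h, hS⟩ := Nat.sInf_mem hne
  exact ⟨e, S, h, fun t => (Finset.le_sup (f := fun t => #(S t)) (mem_univ t)).trans hS.le⟩

theorem RTD_le_card (C : Finset (Concept X)) : RTD C ≤ Fintype.card X := by
  refine RTD_le (e := C.equivFin.symm) (S := fun t => fullSample (C.equivFin.symm t : Concept X))
    (fun t => ⟨consistent_restrict _ _, fun s hts h => hts.ne ?_⟩)
    fun t => (consistent_restrict _ _).card_le
  exact C.equivFin.symm.injective (Subtype.ext
      (eq_of_fullSample_subset (consistent_iff_subset_fullSample.1 h)))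

/-- In a teaching plan whose samples all have the same size, these samples are an antichain. Thus
the full samples can be replaced by the samples of the plan one after the other. -/
theorem STDmin_le_RTD (C : Finset (Concept X)) : STDmin C ≤ RTD C := by
  obtain ⟨e, S₀, hS₀, hd₀⟩ := exists_isTeachingPlan C
  choose S hS₀S hcons hcard using fun t => (hS₀ t).1.exists_superset (hd₀ t) (RTD_le_card C)
  have hnot : ∀ t s, t < s → ¬ Consistent (e s : Concept X) (S t) :=
    fun t s hts h => (hS₀ t).2 s hts (h.mono (hS₀S t))
  have hanti : ∀ t s, s ≠ t → ¬ S t ⊆ S s := by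
    intro t s hne hsub
    have heq : S t = S s := eq_of_subset_of_card_le hsub (by rw [hcard, hcard])
    rcases hne.lt_or_gt with h | h
    · exact hnot s t h (heq ▸ hcons t)
    · exact hnot t s h (heq ▸ hcons s)
  -- in step `k`, the first `k` concepts of the plan have received their final sample
  let M : ℕ → C → Sample X := fun k c =>
    if (e.symm c : ℕ) < k then S (e.symm c) else fullSample (c : Concept X)
  have hSfull : ∀ c : C, S (e.symm c) ⊆ fullSample (c : Concept X) := fun c => by
    have := hcons (e.symm c)
    rwa [e.apply_symm_apply, consistent_iff_subset_fullSample] at this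
  have hMfull : ∀ k c, M k c ⊆ fullSample (c : Concept X) := fun k c => by
    simp only [M]
    split_ifs
    · exact hSfull c
    · exact Subset.rfl
  refine STDmin_le (M := M) (k := #C) (isSubsetTeachingSequence_of_isReduction
    (fun c => by simp [M]) fun k => ⟨fun c => ?_, fun c c' hne => ?_⟩) fun c => ?_
  · simp only [M]
    split_ifs with h1 h2 h2
    · exact Subset.rfl
    · exact hSfull c
    · omega
    · exact Subset.rfl
  · by_cases h1 : (e.symm c : ℕ) < k + 1
    · have hM1 : M (k + 1) c = S (e.symm c) := if_pos h1
      rw [hM1]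
      by_cases h2 : (e.symm c' : ℕ) < k
      · have hM2 : M k c' = S (e.symm c') := if_pos h2
        rw [hM2]
        exact hanti _ _ (e.symm.injective.ne hne)
      · have hM2 : M k c' = fullSample (c' : Concept X) := if_neg h2
        rw [hM2, ← consistent_iff_subset_fullSample]
        have hlt : e.symm c < e.symm c' :=
          lt_of_le_of_ne (Fin.le_def.2 (by omega)) (e.symm.injective.ne hne.symm)
        simpa using hnot _ _ hlt
    · have hM1 : M (k + 1) c = fullSample (c : Concept X) := if_neg h1
      rw [hM1]
      exact fun h => hasAntichainProperty_fullSample C c c' hne.symm (h.trans (hMfull k c'))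
  · have hM : M #C c = S (e.symm c) := if_pos (e.symm c).2
    rw [hM, hcard]

/-- The span of the monomials `∏ x ∈ T, c x` with `|T| ≤ d`, as functions of the concept `c ∈ C`
(where `true` is read as `1`, `false` as `0`). -/
noncomputable def monomialSpan (C : Finset (Concept X)) (d : ℕ) : Submodule ℚ (C → ℚ) :=
  Submodule.span ℚ ((univ.filter fun T : Finset X => #T ≤ d).image
    fun T (c : C) => if ∀ x ∈ T, (c : Concept X) x = true then (1 : ℚ) else 0 : Finset (C → ℚ))

theorem mul_mem_monomialSpan {d : ℕ} {f : C → ℚ} (hf : f ∈ monomialSpan C d) (x : X) :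
    (fun c : C => (if (c : Concept X) x = true then (1 : ℚ) else 0) * f c) ∈
      monomialSpan C (d + 1) := by
  induction hf using Submodule.span_induction with
  | mem f hf =>
    obtain ⟨T, hT, rfl⟩ := mem_image.1 (mem_coe.1 hf)
    refine Submodule.subset_span (mem_coe.2 (mem_image.2 ⟨insert x T, ?_, ?_⟩))
    · have := card_insert_le x T
      simp only [mem_filter, mem_univ, true_and] at hT ⊢
      omega
    · funext c
      simp only [mem_insert, forall_eq_or_imp, ite_and, ite_mul, one_mul, zero_mul]
  | zero =>
    convert Submodule.zero_mem (monomialSpan C (d + 1)) using 1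
    exact funext fun c => mul_zero _
  | add f g _ _ hf hg =>
    convert Submodule.add_mem _ hf hg using 1
    exact funext fun c => mul_add _ _ _
  | smul a f _ hf =>
    convert Submodule.smul_mem _ a hf using 1
    exact funext fun c => mul_left_comm _ _ _

theorem monomialSpan_mono {d d' : ℕ} (h : d ≤ d') : monomialSpan C d ≤ monomialSpan C d' :=
  Submodule.span_mono (coe_subset.2 (image_subset_image fun T hT => by
    simp only [mem_filter, mem_univ, true_and] at hT ⊢
    omega))

/-- The indicator function of consistency with `S` is a polynomial of degree at most `|S|`: the
product of the linear factors `c x`, for `(x, true) ∈ S`, and `1 - c x`, for `(x, false) ∈ S`. -/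
theorem indicator_consistent_mem_monomialSpan (S : Sample X) :
    (fun c : C => if Consistent (c : Concept X) S then (1 : ℚ) else 0) ∈ monomialSpan C #S := by
  induction S using Finset.induction_on with
  | empty =>
    refine Submodule.subset_span (mem_coe.2 (mem_image.2 ⟨∅, by simp, ?_⟩))
    simp [Consistent]
  | insert p S hp ih =>
    rw [card_insert_of_notMem hp]
    have hx := mul_mem_monomialSpan ih p.1
    have hcons : ∀ c : Concept X, Consistent c (insert p S) ↔ c p.1 = p.2 ∧ Consistent c S :=
      fun c => by simp only [Consistent, mem_insert, forall_eq_or_imp]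
    rcases hb : p.2 with _ | _
    · convert Submodule.sub_mem _ (monomialSpan_mono (Nat.le_succ _) ih) hx using 1
      funext c
      simp only [hcons, hb, Pi.sub_apply]
      cases (c : Concept X) p.1 <;> simp
    · convert hx using 1
      funext c
      simp only [hcons, hb]
      cases (c : Concept X) p.1 <;> simp

/-- The indicator functions of consistency with the samples of a teaching plan form a triangular
system, so that they span all functions on `C`. Being polynomials of bounded degree, they lie in
the span of the monomials of that degree, of which there must therefore be at least `|C|`. -/
theorem GMN'_le_RTD (C : Finset (Concept X)) : GMN' C ≤ RTD C := by
  obtain ⟨e, S, hS, hd⟩ := exists_isTeachingPlan C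
  have key : ∀ k ≤ #C, ∀ g : C → ℚ, (∀ c, k ≤ (e.symm c : ℕ) → g c = 0) →
      g ∈ monomialSpan C (RTD C) := by
    intro k
    induction k with
    | zero =>
      intro _ g hg
      rw [show g = 0 from funext fun c => hg c (Nat.zero_le _)]
      exact Submodule.zero_mem _
    | succ k ih =>
      intro hk g hg
      let t : Fin #C := ⟨k, hk⟩
      let F : C → ℚ := fun c => if Consistent (c : Concept X) (S t) then 1 else 0
      have hF : F ∈ monomialSpan C (RTD C) :=
        monomialSpan_mono (hd t) (indicator_consistent_mem_monomialSpan (S t))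
      -- subtracting a multiple of the indicator function `F` annihilates the value at `e t`
      have hsub := ih (by omega) (g - g (e t) • F) fun c hc => by
        rcases hc.eq_or_lt with h | h
        · have hc : c = e t := by
            rw [← e.symm_apply_eq]
            exact Fin.ext h.symm
          have : F c = 1 := if_pos (hc ▸ (hS t).1)
          rw [← hc]
          simp [this]
        · have : F c = 0 := if_neg (by simpa using (hS t).2 (e.symm c) h)
          simp [this, hg c h]
      simpa using Submodule.add_mem _ hsub (Submodule.smul_mem _ (g (e t)) hF)
  have htop : monomialSpan C (RTD C) = ⊤ := eq_top_iff.2 fun g _ =>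
    key #C le_rfl g fun c hc => absurd (e.symm c).2 (not_lt.2 hc)
  have h1 : Module.finrank ℚ (monomialSpan C (RTD C)) ≤ _ := finrank_span_finset_le_card _
  rw [htop, finrank_top, Module.finrank_fintype_fun_eq_card, Fintype.card_coe] at h1
  rw [GMN'_le_iff, ← card_filter_card_le]
  exact h1.trans card_image_le

end RecursiveTeaching

/-! ### The VC-dimension -/

section VCDimension

variable {X : Type u} [DecidableEq X] [Fintype X] {C : Finset (Concept X)}

theorem card_supports (C : Finset (Concept X)) : #(supports C) = #C := by
  refine card_image_of_injective _ fun c c' h => funext fun x => ?_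
  have := Finset.ext_iff.1 h x
  simp only [mem_filter, mem_univ, true_and] at this
  exact Bool.eq_iff_iff.2 this

theorem GMN'_le_VCD (C : Finset (Concept X)) : GMN' C ≤ VCD C := by
  rw [GMN'_le_iff, ← card_supports C, chooseSum, Nat.range_succ_eq_Iic]
  exact (card_le_card_shatterer _).trans card_shatterer_le_sum_vcDim

theorem le_VCD {T : Finset X} (h : ∀ b : X → Bool, ∃ c ∈ C, ∀ x ∈ T, c x = b x) :
    #T ≤ VCD C := by
  refine ((shatters_supports_iff C T).2 fun b => ?_).card_le_vcDim
  obtain ⟨c, hc, hb⟩ := h b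
  refine ⟨c, hc, fun p hp => ?_⟩
  obtain ⟨x, hx, rfl⟩ := mem_image.1 hp
  exact hb x hx

/-- The point `x` can be removed from `T c` if the restriction of `c` to the remaining points is
not contained in the restriction of another concept `c'` to `T c'`. -/
def Removable (T : C → Finset X) (x : X) (c : C) : Prop :=
  ∀ c' : C, c' ≠ c →
    ¬ restrict (c : Concept X) ((T c).erase x) ⊆ restrict (c' : Concept X) (T c')

open Classical in
/-- Removes `x` from all sets `T c` from which this is possible. -/
noncomputable def removePoint (x : X) (T : C → Finset X) (c : C) : Finset X :=
  if Removable T x c then (T c).erase x else T c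

/-- Removes the points of a list in succession, from all sets from which this is possible. -/
noncomputable def removePoints : List X → (C → Finset X) → C → Finset X
  | [], T => T
  | x :: L, T => removePoints L (removePoint x T)

/-- The samples `c|T(c)`. -/
def samplesOf (T : C → Finset X) (c : C) : Sample X := restrict (c : Concept X) (T c)

omit [Fintype X] in
theorem removePoint_subset (x : X) (T : C → Finset X) (c : C) : removePoint x T c ⊆ T c := by
  unfold removePoint
  split_ifs
  · exact erase_subset _ _
  · exact Subset.rfl

omit [Fintype X] in
theorem removePoints_subset (L : List X) (T : C → Finset X) (c : C) :
    removePoints L T c ⊆ T c := by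
  induction L generalizing T with
  | nil => exact Subset.rfl
  | cons x L ih => exact (ih _).trans (removePoint_subset x T c)

omit [Fintype X] in
theorem mem_removePoint_of_ne {x y : X} (h : y ≠ x) {T : C → Finset X} {c : C} (hy : y ∈ T c) :
    y ∈ removePoint x T c := by
  unfold removePoint
  split_ifs
  · exact mem_erase.2 ⟨h, hy⟩
  · exact hy

omit [Fintype X] in
theorem isReduction_removePoint (x : X) {T : C → Finset X}
    (hT : HasAntichainProperty C (samplesOf T)) :
    IsReduction C (samplesOf T) (samplesOf (removePoint x T)) := by
  refine ⟨fun c => image_subset_image (removePoint_subset x T c), fun c c' hne => ?_⟩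
  unfold samplesOf removePoint
  split_ifs with h
  · exact h c' hne
  · exact hT c c' hne.symm

omit [DecidableEq X] [Fintype X] in
theorem IsReduction.hasAntichainProperty {M M' : C → Sample X} (h : IsReduction C M M') :
    HasAntichainProperty C M' :=
  fun c c' hne hsub => h.2 c c' hne.symm (hsub.trans (h.1 c'))

omit [Fintype X] in
theorem reflTransGen_removePoints (L : List X) {T : C → Finset X}
    (hT : HasAntichainProperty C (samplesOf T)) :
    Relation.ReflTransGen (IsReduction C) (samplesOf T) (samplesOf (removePoints L T)) := by
  induction L generalizing T with
  | nil => exact .refl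
  | cons x L ih =>
    have h := isReduction_removePoint x hT
    exact .head h (ih h.hasAntichainProperty)

omit [Fintype X] in
/-- The points of `L` that remain after the removal are shattered. The reason: if `x` could not be
removed from the set of `c`, then there is a concept that agrees with `c` on all points still to be
processed, but not at `x`. For the induction, the concepts that realize the labelings have to retain
the points that `c` has retained before. -/
theorem exists_eq_on_removePoints (L : List X) (hL : L.Nodup) {T : C → Finset X}
    (hT : HasAntichainProperty C (samplesOf T)) (hLT : ∀ c, ∀ x ∈ L, x ∈ T c) (c : C)
    (b : X → Bool) :
    ∃ c' : C, (∀ y ∈ T c, y ∉ L → y ∈ T c') ∧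
      ∀ y ∈ L, y ∈ removePoints L T c → (c' : Concept X) y = b y := by
  induction L generalizing T with
  | nil => exact ⟨c, fun y hy _ => hy, by simp⟩
  | cons x L ih =>
    obtain ⟨hxL, hL⟩ := List.nodup_cons.1 hL
    obtain ⟨c₁, h1, h2⟩ := ih hL (isReduction_removePoint x hT).hasAntichainProperty
      fun c' y hy => mem_removePoint_of_ne (fun h : y = x => hxL (h ▸ hy))
        (hLT c' y (List.mem_cons_of_mem _ hy))
    have h3 : ∀ y ∈ T c, y ∉ x :: L → y ∈ T c₁ := fun y hy hyL => by
      rw [List.mem_cons, not_or] at hyL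
      exact removePoint_subset x T c₁ (h1 y (mem_removePoint_of_ne hyL.1 hy) hyL.2)
    by_cases hgood : x ∈ removePoints (x :: L) T c → (c₁ : Concept X) x = b x
    · refine ⟨c₁, h3, fun y hy hyT => ?_⟩
      rcases List.mem_cons.1 hy with rfl | hy
      · exact hgood hyT
      · exact h2 y hy hyT
    · push Not at hgood
      obtain ⟨hxc, hne⟩ := hgood
      -- `c` has retained `x`, hence so has `c₁`; this is witnessed by a concept `c₂`
      have hx₁ : x ∈ removePoint x T c₁ := h1 x (removePoints_subset L _ c hxc) hxL
      have hnot : ¬ Removable T x c₁ := fun h => by simp [removePoint, h] at hx₁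
      unfold Removable at hnot
      push Not at hnot
      obtain ⟨c₂, hc₂, hsub⟩ := hnot
      obtain ⟨hT₂, hagree⟩ := restrict_subset_restrict.1 hsub
      have hflip : (c₂ : Concept X) x ≠ (c₁ : Concept X) x := fun heq => by
        refine hT c₁ c₂ hc₂.symm (restrict_subset_restrict.2 ⟨fun y hy => ?_, fun y hy => ?_⟩) <;>
          rcases eq_or_ne y x with rfl | hyx
        · exact hLT c₂ y (List.mem_cons_self ..)
        · exact hT₂ (mem_erase.2 ⟨hyx, hy⟩)
        · exact heq
        · exact hagree y (mem_erase.2 ⟨hyx, hy⟩)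
      refine ⟨c₂, fun y hy hyL => hT₂ (mem_erase.2
        ⟨fun h => hyL (h ▸ List.mem_cons_self ..), h3 y hy hyL⟩), fun y hy hyT => ?_⟩
      rcases List.mem_cons.1 hy with rfl | hy
      · revert hne hflip
        cases (c₂ : Concept X) y <;> cases (c₁ : Concept X) y <;> cases b y <;> simp
      · rw [hagree y (mem_erase.2 ⟨fun h => hxL (h ▸ hy), hLT c₁ y (List.mem_cons_of_mem _ hy)⟩)]
        exact h2 y hy hyT

theorem STDmin_le_VCD (C : Finset (Concept X)) : STDmin C ≤ VCD C := by
  have hT : HasAntichainProperty C (samplesOf fun _ => univ) := hasAntichainProperty_fullSample C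
  refine STDmin_le_of_reflTransGen (reflTransGen_removePoints univ.toList hT) fun c => ?_
  rw [samplesOf, card_restrict]
  refine le_VCD fun b => ?_
  obtain ⟨c', -, h⟩ := exists_eq_on_removePoints univ.toList (nodup_toList _) hT
    (fun _ x _ => mem_univ x) c b
  exact ⟨c', c'.2, fun x hx => h x (by simp) hx⟩

end VCDimension

/-! ### Counting realizable samples of a given size -/

section Counting

variable {X : Type u} [DecidableEq X] [Fintype X]

/-- The `C`-realizable samples of size exactly `d` whose points belong to `Y`. -/
def samplesOn (C : Finset (Concept X)) (Y : Finset X) (d : ℕ) : Finset (Sample X) :=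
  univ.filter fun S => Realizable C S ∧ #S = d ∧ ∀ p ∈ S, p.1 ∈ Y

theorem mem_samplesOn {C : Finset (Concept X)} {Y : Finset X} {d : ℕ} {S : Sample X} :
    S ∈ samplesOn C Y d ↔ Realizable C S ∧ #S = d ∧ ∀ p ∈ S, p.1 ∈ Y := by
  simp [samplesOn]

/-- The concepts of `C` that take the value `b` at `x`. -/
def fiber (C : Finset (Concept X)) (x : X) (b : Bool) : Finset (Concept X) :=
  C.filter fun c => c x = b

omit [DecidableEq X] [Fintype X] in
theorem card_fiber_add_card_fiber (C : Finset (Concept X)) (x : X) (b : Bool) :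
    #(fiber C x b) + #(fiber C x !b) = #C := by
  unfold fiber
  rw [← card_filter_add_card_filter_not (s := C) fun c => c x = b]
  congr 2
  ext c
  cases c x <;> cases b <;> simp

theorem card_samplesOn_fiber_le (C : Finset (Concept X)) {Y : Finset X} {x : X} (hx : x ∈ Y)
    (b : Bool) (d : ℕ) :
    #(samplesOn (fiber C x b) (Y.erase x) d) ≤
      #((samplesOn C Y (d + 1)).filter fun S => (x, b) ∈ S) := by
  have hnot : ∀ S ∈ samplesOn (fiber C x b) (Y.erase x) d, (x, b) ∉ S := fun S hS h =>
    absurd rfl (mem_erase.1 ((mem_samplesOn.1 hS).2.2 _ h)).1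
  refine card_le_card_of_injOn (insert (x, b)) (fun S hS => ?_) fun S hS S' hS' h => ?_
  · obtain ⟨⟨c, hc, hcons⟩, hcard, hY⟩ := mem_samplesOn.1 hS
    obtain ⟨hc, hcx⟩ := mem_filter.1 hc
    refine mem_coe.2 (mem_filter.2 ⟨mem_samplesOn.2 ⟨⟨c, hc, ?_⟩, ?_, ?_⟩, mem_insert_self _ _⟩)
    · exact forall_mem_insert _ _ _ |>.2 ⟨hcx, hcons⟩
    · rw [card_insert_of_notMem (hnot S hS), hcard]
    · exact forall_mem_insert _ _ _ |>.2 ⟨hx, fun p hp => mem_of_mem_erase (hY p hp)⟩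
  · rw [← erase_insert (hnot S hS), h, erase_insert (hnot S' hS')]

/-- Double counting of the pairs of a sample and one of its elements. -/
theorem sum_card_samplesOn_fiber_le (C : Finset (Concept X)) (Y : Finset X) (d : ℕ) :
    ∑ x ∈ Y, ∑ b : Bool, #(samplesOn (fiber C x b) (Y.erase x) d) ≤
      (d + 1) * #(samplesOn C Y (d + 1)) := by
  calc _ ≤ ∑ x ∈ Y, ∑ b : Bool, #((samplesOn C Y (d + 1)).filter fun S => (x, b) ∈ S) :=
        sum_le_sum fun x hx => sum_le_sum fun b _ => card_samplesOn_fiber_le C hx b d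
    _ = ∑ p ∈ Y ×ˢ (univ : Finset Bool), #((samplesOn C Y (d + 1)).filter fun S => p ∈ S) :=
        (sum_product _ _ fun p => #((samplesOn C Y (d + 1)).filter fun S => p ∈ S)).symm
    _ = ∑ S ∈ samplesOn C Y (d + 1), #((Y ×ˢ (univ : Finset Bool)).filter fun p => p ∈ S) :=
        sum_card_bipartiteAbove_eq_sum_card_bipartiteBelow fun p S => p ∈ S
    _ ≤ ∑ S ∈ samplesOn C Y (d + 1), (d + 1) := sum_le_sum fun S hS => by
        rw [← (mem_samplesOn.1 hS).2.1]
        exact card_le_card fun p hp => (mem_filter.1 hp).2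
    _ = _ := by rw [sum_const, smul_eq_mul, mul_comm]

/-- The samples that do not contain the point `x`, and those that assign to it one of the two
labels. -/
theorem add_card_samplesOn_fiber_le (C : Finset (Concept X)) {Y : Finset X} {x : X} (hx : x ∈ Y)
    (b : Bool) (d : ℕ) :
    #(samplesOn (fiber C x b) (Y.erase x) (d + 1)) + #(samplesOn (fiber C x b) (Y.erase x) d) +
      #(samplesOn (fiber C x !b) (Y.erase x) d) ≤ #(samplesOn C Y (d + 1)) := by
  have h1 := card_samplesOn_fiber_le C hx b d
  have h2 := card_samplesOn_fiber_le C hx (!b) d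
  have hd1 : Disjoint (samplesOn (fiber C x b) (Y.erase x) (d + 1))
      ((samplesOn C Y (d + 1)).filter fun S => (x, b) ∈ S) := by
    refine disjoint_left.2 fun S hS hS' => ?_
    exact absurd rfl (mem_erase.1 ((mem_samplesOn.1 hS).2.2 _ (mem_filter.1 hS').2)).1
  have hd2 : Disjoint (samplesOn (fiber C x b) (Y.erase x) (d + 1) ∪
      ((samplesOn C Y (d + 1)).filter fun S => (x, b) ∈ S))
      ((samplesOn C Y (d + 1)).filter fun S => (x, !b) ∈ S) := by
    refine disjoint_left.2 fun S hS hS' => ?_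
    obtain ⟨hS', hb'⟩ := mem_filter.1 hS'
    rcases mem_union.1 hS with hS | hS
    · exact absurd rfl (mem_erase.1 ((mem_samplesOn.1 hS).2.2 _ hb')).1
    · obtain ⟨⟨c, -, hc⟩, -⟩ := mem_samplesOn.1 hS'
      have e1 : c x = b := hc _ (mem_filter.1 hS).2
      have e2 : c x = !b := hc _ hb'
      exact Bool.not_ne_self b (e2.symm.trans e1)
  have hsub : samplesOn (fiber C x b) (Y.erase x) (d + 1) ∪
      ((samplesOn C Y (d + 1)).filter fun S => (x, b) ∈ S) ∪
      ((samplesOn C Y (d + 1)).filter fun S => (x, !b) ∈ S) ⊆ samplesOn C Y (d + 1) := by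
    refine union_subset (union_subset (fun S hS => ?_) (filter_subset _ _)) (filter_subset _ _)
    obtain ⟨⟨c, hc, hcons⟩, hcard, hY⟩ := mem_samplesOn.1 hS
    exact mem_samplesOn.2 ⟨⟨c, (mem_filter.1 hc).1, hcons⟩, hcard,
      fun p hp => mem_of_mem_erase (hY p hp)⟩
  have := card_le_card hsub
  rw [card_union_of_disjoint hd2, card_union_of_disjoint hd1] at this
  omega

/-- A class that is determined by its values on `n ≥ d` points has at least
`min |C| (∑ i ≤ d, n.choose i)` realizable samples of size exactly `d` on these points.

The induction removes a point `x` at which one of the two fibers of `C` has fewer than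
`∑ i < d, (n - 1).choose i` elements. If there is no such point, then by the induction hypothesis
every labeled point belongs to at least that many samples, and double counting applies. -/
theorem min_le_card_samplesOn (n d : ℕ) (hd : d ≤ n) (C : Finset (Concept X)) (Y : Finset X)
    (hY : #Y = n) (hC : ∀ c ∈ C, ∀ c' ∈ C, (∀ x ∈ Y, c x = c' x) → c = c') :
    min #C (chooseSum d n) ≤ #(samplesOn C Y d) := by
  induction n generalizing d C Y with
  | zero =>
    obtain rfl : d = 0 := by omega
    rcases C.eq_empty_or_nonempty with rfl | ⟨c, hc⟩
    · simp
    · refine (min_le_right _ _).trans ?_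
      rw [chooseSum_self, pow_zero]
      exact card_pos.2 ⟨∅, mem_samplesOn.2 ⟨⟨c, hc, by simp [Consistent]⟩, by simp⟩⟩
  | succ n ih =>
    rcases Nat.eq_zero_or_pos d with rfl | hd0
    · rcases C.eq_empty_or_nonempty with rfl | ⟨c, hc⟩
      · simp
      · refine (min_le_right _ _).trans ?_
        rw [show chooseSum 0 (n + 1) = 1 by simp [chooseSum]]
        exact card_pos.2 ⟨∅, mem_samplesOn.2 ⟨⟨c, hc, by simp [Consistent]⟩, by simp⟩⟩
    obtain ⟨k, rfl⟩ : ∃ k, d = k + 1 := ⟨d - 1, by omega⟩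
    rcases hd.eq_or_lt with hkn | hkn
    · -- for `d = n` the samples are the restrictions of the concepts to `Y`
      refine (min_le_left _ _).trans
        (card_le_card_of_injOn (fun c => restrict c Y) (fun c hc => ?_) fun c hc c' hc' h => ?_)
      · exact mem_samplesOn.2 ⟨⟨c, hc, consistent_restrict c Y⟩,
          by rw [card_restrict, hY, ← hkn], fun p hp => (mem_restrict.1 hp).1⟩
      · exact hC c hc c' hc' fun x hx => ((restrict_subset_restrict.1 (le_of_eq h)).2 x hx).symm
    have hkn' : k + 1 ≤ n := by omega
    have hfib : ∀ x ∈ Y, ∀ b, ∀ c ∈ fiber C x b, ∀ c' ∈ fiber C x b,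
        (∀ y ∈ Y.erase x, c y = c' y) → c = c' := by
      intro x hx b c hc c' hc' h
      obtain ⟨hc, hcx⟩ := mem_filter.1 hc
      obtain ⟨hc', hcx'⟩ := mem_filter.1 hc'
      refine hC c hc c' hc' fun y hy => ?_
      rcases eq_or_ne y x with rfl | hyx
      · rw [hcx, hcx']
      · exact h y (mem_erase.2 ⟨hyx, hy⟩)
    have hcardY : ∀ x ∈ Y, #(Y.erase x) = n := fun x hx => by
      rw [card_erase_of_mem hx, hY, Nat.add_sub_cancel]
    by_cases hlarge : ∀ x ∈ Y, ∀ b, chooseSum k n ≤ #(fiber C x b)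
    · refine (min_le_right _ _).trans (le_of_mul_le_mul_left ?_ (Nat.succ_pos k))
      refine (mul_chooseSum_succ_le (by omega)).trans
        (le_trans ?_ (sum_card_samplesOn_fiber_le C Y k))
      calc 2 * ((n + 1) * chooseSum k n) = ∑ x ∈ Y, ∑ _b : Bool, chooseSum k n := by
            simp [hY]
            ring
        _ ≤ _ := sum_le_sum fun x hx => sum_le_sum fun b _ => by
            have := ih k (by omega) (fiber C x b) (Y.erase x) (hcardY x hx) (hfib x hx b)
            rwa [min_eq_right (hlarge x hx b)] at this
    · push Not at hlarge
      obtain ⟨x, hx, b, hb⟩ := hlarge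
      have h1 := ih (k + 1) hkn' _ _ (hcardY x hx) (hfib x hx !b)
      have h2 := ih k (by omega) _ _ (hcardY x hx) (hfib x hx !b)
      have h3 := ih k (by omega) _ _ (hcardY x hx) (hfib x hx b)
      have h4 := add_card_samplesOn_fiber_le C hx (!b) k
      have h5 := card_fiber_add_card_fiber C x b
      have h6 := chooseSum_mono (Nat.le_succ k) n
      -- the samples without `x` account for the fiber of `!b`, up to `chooseSum (k + 1) n`; those
      -- with `(x, b)` account for the fiber of `b`, and if the fiber of `!b` is larger than
      -- `chooseSum (k + 1) n`, those with `(x, !b)` account for the remaining `chooseSum k n`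
      rw [chooseSum_succ_succ]
      rw [Bool.not_not] at h4
      omega

/-- There are at least `|C|` realizable samples of size exactly `GMN' C`; samples of the same size
form an antichain. -/
theorem AMN'_le_GMN' (C : Finset (Concept X)) : AMN' C ≤ GMN' C := by
  have h := min_le_card_samplesOn (Fintype.card X) (GMN' C) (GMN'_le_card C) C univ card_univ
    fun c _ c' _ h => funext fun x => h x (mem_univ x)
  rw [min_eq_left (GMN'_le_iff.1 le_rfl)] at h
  obtain ⟨A, hA, hcard⟩ := exists_subset_card_eq h
  refine Nat.sInf_le ⟨A, fun S hS => ?_, hcard, fun S hS S' hS' hne hsub => hne ?_⟩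
  · obtain ⟨h1, h2, -⟩ := mem_samplesOn.1 (hA hS)
    exact mem_realizableSamples.2 ⟨h1, h2.le⟩
  · exact eq_of_subset_of_card_le hsub
      (by rw [(mem_samplesOn.1 (hA hS)).2.1, (mem_samplesOn.1 (hA hS')).2.1])

end Counting

/-! ### Bounds for the separating examples -/

section LowerBounds

variable {X : Type u} [DecidableEq X] [Fintype X] {C : Finset (Concept X)}

/-- If every concept in `C` agrees with another one at any given point, then no concept has a
teaching set with fewer than two elements, so that no teaching plan of order `1` can begin. -/
theorem one_lt_RTD [Nonempty X] (hne : C.Nonempty)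
    (h : ∀ c ∈ C, ∀ x, ∃ c' ∈ C, c' ≠ c ∧ c' x = c x) : 1 < RTD C := by
  obtain ⟨e, S, hS, hd⟩ := exists_isTeachingPlan C
  by_contra! hle
  let t : Fin #C := ⟨0, card_pos.2 hne⟩
  obtain ⟨p, hp⟩ := card_le_one_iff_subset_singleton.1 ((hd t).trans hle)
  obtain ⟨c', hc', hne', hx⟩ := h (e t) (e t).2 p.1
  have ht : t < e.symm ⟨c', hc'⟩ := by
    refine lt_of_le_of_ne (Fin.le_def.2 (Nat.zero_le _)) fun heq => hne' ?_
    rw [heq, e.apply_symm_apply]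
  refine (hS t).2 _ ht fun q hq => ?_
  rw [e.apply_symm_apply]
  obtain rfl : q = p := mem_singleton.1 (hp hq)
  exact hx.trans ((hS t).1 q hq)

/-- The labeled points that are consistent with some concept in `D`. Besides the empty sample, only
these are available for the concepts in `D` in a matching of cost `1`. -/
def labeledPoints (D : Finset (Concept X)) : Finset (X × Bool) :=
  univ.filter fun p => ∃ c ∈ D, c p.1 = p.2

theorem card_le_of_SMN_le_one (h : SMN C ≤ 1) {D : Finset (Concept X)} (hD : D ⊆ C) :
    #D ≤ #(labeledPoints D) + 1 := by
  obtain ⟨M, hM, hc⟩ := exists_cost_eq_SMN C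
  have hle : ∀ c, #(M c) ≤ 1 := cost_le_iff.1 (hc.le.trans h)
  calc #D = #(D.attach.image fun c : D => M ⟨c, hD c.2⟩) := by
        rw [card_image_of_injective (f := fun c : D => M ⟨c, hD c.2⟩) _
          fun c c' h => Subtype.ext (Subtype.ext_iff.1 (hM.2 h) :), card_attach]
    _ ≤ #(insert ∅ ((labeledPoints D).image singleton)) := card_le_card fun S hS => by
        obtain ⟨c, -, rfl⟩ := mem_image.1 hS
        rcases (M ⟨c, hD c.2⟩).eq_empty_or_nonempty with h0 | h0
        · rw [h0]
          exact mem_insert_self _ _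
        · obtain ⟨p, hp⟩ := card_eq_one.1 (le_antisymm (hle _) (card_pos.2 h0))
          have hcp : (c : Concept X) p.1 = p.2 :=
            hM.1 ⟨c, hD c.2⟩ p (hp ▸ mem_singleton_self p)
          rw [hp]
          exact mem_insert_of_mem (mem_image_of_mem _
            (mem_filter.2 ⟨mem_univ _, c, c.2, hcp⟩))
    _ ≤ #(labeledPoints D) + 1 :=
        (card_insert_le _ _).trans (Nat.succ_le_succ card_image_le)

theorem card_le_of_AMN'_le_one (h : AMN' C ≤ 1) (hC : 1 < #C) : #C ≤ 2 * Fintype.card X := by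
  obtain ⟨A, hA, hcard, hanti⟩ := exists_antichain_AMN' C
  have hsub : A ⊆ (univ : Finset (X × Bool)).image singleton := fun S hS => by
    rcases S.eq_empty_or_nonempty with rfl | h0
    · -- the empty sample would be comparable to any other element of the antichain
      obtain ⟨S', hS', hne⟩ := exists_mem_ne (hcard ▸ hC) ∅
      exact absurd (empty_subset S') (hanti hS hS' hne.symm)
    · obtain ⟨p, rfl⟩ := card_eq_one.1
        (le_antisymm ((mem_realizableSamples.1 (hA hS)).2.trans h) (card_pos.2 h0))
      exact mem_image_of_mem _ (mem_univ p)
  calc #C = #A := hcard.symm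
    _ ≤ _ := (card_le_card hsub).trans card_image_le
    _ = 2 * Fintype.card X := by simp [mul_comm]

/-- If `|M c| > 1`, then the samples `{(x, c x)}` with `x ∈ I` are occupied by other concepts. -/
theorem IsGreedyMatching.card_le {M : C → Sample X} (hM : IsGreedyMatching C M) {c : C}
    (hc : 1 < #(M c)) (I : Finset X) :
    #I ≤ #((C.erase c).filter fun c' => ∃ x ∈ I, c' x = (c : Concept X) x) := by
  choose f hf hMf using fun x => hM.exists_eq (consistent_restrict (c : Concept X) {x})
    (by rwa [card_restrict, card_singleton])
  refine card_le_card_of_injOn (fun x => (f x : Concept X)) (fun x hx => ?_) fun x _ y _ h => ?_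
  · refine mem_filter.2 ⟨mem_erase.2 ⟨fun h => hf x (Subtype.ext h), (f x).2⟩, x, hx, ?_⟩
    exact hM.1.1 (f x) (x, (c : Concept X) x)
      (hMf x ▸ mem_restrict.2 ⟨mem_singleton_self x, rfl⟩)
  · have h' : f x = f y := Subtype.ext h
    exact singleton_injective (restrict_injective _ ((hMf x).symm.trans (h' ▸ hMf y)))

/-- In the full cube, no full sample can be reduced, as every point is needed to distinguish a
concept from one of its neighbors. -/
theorem card_le_STDmin_univ (X : Type u) [DecidableEq X] [Fintype X] :
    Fintype.card X ≤ STDmin (univ : Finset (Concept X)) := by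
  obtain ⟨M, hM, hc⟩ := exists_sequence_cost_eq_STDmin (univ : Finset (Concept X))
  have hfull : ∀ k c, M k c = fullSample (c : Concept X) := by
    intro k
    induction k with
    | zero => exact hM.2.1
    | succ k ih =>
      intro c
      refine Subset.antisymm (ih c ▸ hM.2.2.1 k c) fun p hp => ?_
      by_contra hpM
      let c' : (univ : Finset (Concept X)) :=
        ⟨Function.update (c : Concept X) p.1 (!p.2), mem_univ _⟩
      have hcp : (c : Concept X) p.1 = p.2 := consistent_restrict _ _ p hp
      refine hM.2.2.2 k c c' (fun h => ?_) fun q hq => ?_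
      · have := congrFun (Subtype.ext_iff.1 h) p.1
        simp [c', hcp] at this
      · have hcq := (hM.1 (k + 1)).1 c q hq
        rw [ih]
        refine mem_restrict.2 ⟨mem_univ _, ?_⟩
        have hne : q.1 ≠ p.1 := fun h => hpM (by
          rwa [show p = q from Prod.ext h.symm (by rw [← hcp, ← h, hcq])])
        simpa [c', hne] using hcq
  rw [← hc]
  refine le_trans ?_ (Finset.le_sup (f := fun c => #(M _ c)) (mem_univ ⟨fun _ => true, mem_univ _⟩))
  simp only [hfull, fullSample_eq_restrict, card_restrict, card_univ, le_refl]

end LowerBounds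

/-! ### The square -/

section Square

/-- The four concepts on two points are matched with the four labeled points. -/
theorem AMN_square_le : AMN (univ : Finset (Concept (Fin 2))) ≤ 1 := by
  have hanti : ∀ c c' : Concept (Fin 2), c ≠ c' →
      ¬ restrict c {if c 0 = c 1 then 0 else 1} ⊆ restrict c' {if c' 0 = c' 1 then 0 else 1} := by
    decide
  have hA : HasAntichainProperty (univ : Finset (Concept (Fin 2)))
      (fun c => restrict (c : Concept (Fin 2)) {if c.1 0 = c.1 1 then 0 else 1}) :=
    fun c c' hne => hanti c c' fun h => hne (Subtype.ext h)
  refine AMN_le (M := fun c => restrict (c : Concept (Fin 2)) {if c.1 0 = c.1 1 then 0 else 1})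
    ⟨fun c => consistent_restrict _ _, fun c c' h => ?_⟩ hA fun c => by simp [card_restrict]
  by_contra hne
  exact hA c c' hne h.subset

/-- The matching that assigns to every concept its positively labeled points is greedy on the
square. -/
theorem two_le_GMN_square : 2 ≤ GMN (univ : Finset (Concept (Fin 2))) := by
  let M : Concept (Fin 2) → Sample (Fin 2) := fun c => restrict c (univ.filter fun x => c x = true)
  have hinj : ∀ c c', M c = M c' → c = c' := by decide
  have hocc : ∀ c S, Consistent c S → #S < #(M c) → ∃ c', c' ≠ c ∧ M c' = S := by decide
  have hM : IsGreedyMatching (univ : Finset (Concept (Fin 2))) fun c => M c := by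
    refine ⟨⟨fun c => consistent_restrict _ _, fun c c' h => Subtype.ext (hinj c c' h)⟩, ?_⟩
    rintro M' ⟨hM', c, hsame, hlt⟩
    obtain ⟨c', hne, heq⟩ := hocc c (M' c) (hM'.1 c) hlt
    have hne' : (⟨c', mem_univ c'⟩ : (univ : Finset (Concept (Fin 2)))) ≠ c :=
      fun h => hne (Subtype.ext_iff.1 h)
    exact hne' (hM'.2 ((hsame _ hne').trans heq))
  refine le_trans ?_ (cost_le_GMN hM)
  exact le_trans (show 2 ≤ #(M fun _ => true) by decide)
    (Finset.le_sup (f := fun c : (univ : Finset (Concept (Fin 2))) => #(M c))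
      (mem_univ ⟨fun _ => true, mem_univ _⟩))

theorem two_le_GMN'_square : 2 ≤ GMN' (univ : Finset (Concept (Fin 2))) := by
  by_contra! h
  have := GMN'_le_iff.1 (Nat.lt_succ_iff.1 h)
  simp [chooseSum, sum_range_succ] at this

end Square

/-! ### The square with a constant coordinate -/

section FlatSquare

/-- The full square on the first two of three points. -/
def flatSquare : Finset (Concept (Fin 3)) :=
  univ.image fun p : Bool × Bool => ![p.1, p.2, false]

theorem GMN'_flatSquare_le : GMN' flatSquare ≤ 1 :=
  GMN'_le_iff.2 (by decide)

theorem two_le_VCD_flatSquare : 2 ≤ VCD flatSquare :=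
  le_VCD (T := {0, 1}) fun b => ⟨![b 0, b 1, false],
    mem_image.2 ⟨(b 0, b 1), mem_univ _, rfl⟩, by simp⟩

theorem one_lt_RTD_flatSquare : 1 < RTD flatSquare :=
  one_lt_RTD (by decide) (by decide)

end FlatSquare

/-! ### Concepts of even parity -/

section EvenParity

/-- The concepts on three points with an even number of ones. -/
def evenParity : Finset (Concept (Fin 3)) :=
  univ.image fun p : Bool × Bool => ![p.1, p.2, xor p.1 p.2]

theorem two_le_VCD_evenParity : 2 ≤ VCD evenParity :=
  le_VCD (T := {0, 1}) fun b => ⟨![b 0, b 1, xor (b 0) (b 1)],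
    mem_image.2 ⟨(b 0, b 1), mem_univ _, rfl⟩, by simp⟩

theorem one_lt_RTD_evenParity : 1 < RTD evenParity :=
  one_lt_RTD (by decide) (by decide)

/-- Three reductions lead to samples of size `1`: any two points determine a concept of the class;
a suitable choice of two points for each concept leaves `(0, false)` and `(1, true)` in one sample
only; after these have been chosen, `(2, false)` and `(2, true)` are left in one sample only. -/
theorem STDmin_evenParity_le : STDmin evenParity ≤ 1 := by
  let T₁ : Concept (Fin 3) → Finset (Fin 3) := fun c =>
    if c 0 then {0, 2} else if c 1 then {1, 2} else {0, 1}
  let T₂ : Concept (Fin 3) → Finset (Fin 3) := fun c =>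
    if c 0 then {0, 2} else if c 1 then {1} else {0}
  let T₃ : Concept (Fin 3) → Finset (Fin 3) := fun c =>
    if c 0 then {2} else if c 1 then {1} else {0}
  have hred : ∀ T T' : Concept (Fin 3) → Finset (Fin 3), (∀ c ∈ evenParity, T' c ⊆ T c) →
      (∀ c ∈ evenParity, ∀ c' ∈ evenParity, c' ≠ c → ¬ restrict c (T' c) ⊆ restrict c' (T c')) →
      IsReduction evenParity (samplesOf fun c => T c) (samplesOf fun c => T' c) :=
    fun T T' h1 h2 => ⟨fun c => image_subset_image (h1 c c.2),
      fun c c' hne => h2 c c.2 c' c'.2 fun h => hne (Subtype.ext h)⟩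
  have h₁ := hred (fun _ => univ) T₁ (by decide) (by decide)
  have h₂ := hred T₁ T₂ (by decide) (by decide)
  have h₃ := hred T₂ T₃ (by decide) (by decide)
  refine STDmin_le_of_reflTransGen (((Relation.ReflTransGen.single h₁).tail h₂).tail h₃)
    fun c => ?_
  rw [samplesOf, card_restrict]
  revert c
  have : ∀ c ∈ evenParity, #(T₃ c) ≤ 1 := by decide
  exact fun c => this c c.2

end EvenParity

/-! ### The cube without one concept -/

section PuncturedCube

/-- All concepts on three points but one. -/
def puncturedCube : Finset (Concept (Fin 3)) := univ.erase fun _ => true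

theorem card_puncturedCube : #puncturedCube = 7 := by decide

/-- The concepts of weight `1` are matched with their positively labeled point, those of weight `2`
with their negatively labeled point, and the remaining concept with the empty sample. -/
theorem SMN_puncturedCube_le : SMN puncturedCube ≤ 1 := by
  let T : Concept (Fin 3) → Finset (Fin 3) := fun c =>
    if #(univ.filter fun x => c x = true) ≤ 1 then univ.filter fun x => c x = true
    else univ.filter fun x => c x = false
  have hinj : ∀ c ∈ puncturedCube, ∀ c' ∈ puncturedCube, restrict c (T c) = restrict c' (T c') →
      c = c' := by decide
  have hT : ∀ c ∈ puncturedCube, #(T c) ≤ 1 := by decide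
  refine SMN_le (M := fun c => restrict (c : Concept (Fin 3)) (T c))
    ⟨fun c => consistent_restrict _ _, fun c c' h => Subtype.ext (hinj c c.2 c' c'.2 h)⟩
    fun c => ?_
  rw [card_restrict]
  exact hT c c.2

theorem two_le_AMN'_puncturedCube : 2 ≤ AMN' puncturedCube := by
  by_contra! h
  have := card_le_of_AMN'_le_one (Nat.lt_succ_iff.1 h) (by simp [card_puncturedCube])
  simp [card_puncturedCube] at this

end PuncturedCube

/-! ### The cube with a repeated coordinate -/

section RepeatedPoint

/-- The full cube on three points, the first of which is repeated four times. -/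
def repeatedPoint : Finset (Concept (Fin 6)) :=
  univ.image fun p : Bool × Bool × Bool => ![p.1, p.1, p.1, p.1, p.2.1, p.2.2]

theorem two_le_GMN'_repeatedPoint : 2 ≤ GMN' repeatedPoint := by
  by_contra! h
  exact absurd (GMN'_le_iff.1 (Nat.lt_succ_iff.1 h)) (by decide)

/-- On the four copies of the repeated point, a concept agrees with only three others. These cannot
occupy the four samples that consist of one of the copies. -/
theorem GMN_repeatedPoint_le : GMN repeatedPoint ≤ 1 := by
  have hcard : ∀ c ∈ repeatedPoint,
      #((repeatedPoint.erase c).filter fun c' => ∃ x ∈ ({0, 1, 2, 3} : Finset (Fin 6)),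
        c' x = c x) ≤ 3 := by decide
  obtain ⟨M₀, hM₀⟩ := exists_isGreedyMatching repeatedPoint
  refine csSup_le ⟨_, M₀, hM₀, rfl⟩ ?_
  rintro _ ⟨M, hM, rfl⟩
  refine cost_le_iff.2 fun c => ?_
  by_contra! h
  have h1 := Nat.le_trans (hM.card_le h {0, 1, 2, 3}) (by convert hcard c c.2)
  exact absurd h1 (by decide)

end RepeatedPoint

/-! ### The extended cube -/

section ExtendedCube

/-- The full cube on the first four of nine points; the concepts vanish at the other points. -/
def cubeFace : Finset (Concept (Fin 9)) :=
  univ.image fun p : Bool × Bool × Bool × Bool =>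
    ![p.1, p.2.1, p.2.2.1, p.2.2.2, false, false, false, false, false]

/-- The concepts of `cubeFace`, and the concept that is `1` everywhere. -/
def extendedCube : Finset (Concept (Fin 9)) := insert (fun _ => true) cubeFace

theorem card_cubeFace : #cubeFace = 16 := by
  rw [cubeFace, card_image_of_injective _ (by decide)]
  rfl

theorem const_false_mem_cubeFace : (fun _ => false) ∈ cubeFace :=
  mem_image.2 ⟨(false, false, false, false), mem_univ _, by decide⟩

/-- All `18` labeled points are realizable, and they form an antichain. -/
theorem AMN'_extendedCube_le : AMN' extendedCube ≤ 1 := by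
  have hcard : #extendedCube ≤
      #((univ : Finset (Fin 9 × Bool)).image fun p => ({p} : Sample (Fin 9))) := by
    rw [card_image_of_injective _ singleton_injective]
    refine (card_insert_le _ _).trans ?_
    rw [card_cubeFace]
    decide
  obtain ⟨A, hA, hAcard⟩ := exists_subset_card_eq hcard
  refine Nat.sInf_le ⟨A, fun S hS => ?_, hAcard, fun S hS S' hS' hne hsub => hne ?_⟩
  · obtain ⟨⟨x, b⟩, -, rfl⟩ := mem_image.1 (hA hS)
    refine mem_realizableSamples.2 ⟨?_, by simp⟩
    cases b
    · exact ⟨_, mem_insert_of_mem const_false_mem_cubeFace, by simp [Consistent]⟩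
    · exact ⟨_, mem_insert_self _ _, by simp [Consistent]⟩
  · obtain ⟨p, -, rfl⟩ := mem_image.1 (hA hS)
    obtain ⟨q, -, rfl⟩ := mem_image.1 (hA hS')
    rw [singleton_subset_singleton] at hsub
    rw [hsub]

/-- Only `14` samples of size at most `1` are available for the `16` concepts in `cubeFace`. -/
theorem two_le_SMN_extendedCube : 2 ≤ SMN extendedCube := by
  by_contra! h
  have h1 := card_le_of_SMN_le_one (Nat.lt_succ_iff.1 h) (subset_insert _ cubeFace)
  have h2 : labeledPoints cubeFace ⊆
      univ.filter fun p : Fin 9 × Bool => p.1 < 4 ∨ p.2 = false := fun p hp => by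
    obtain ⟨-, c, hc, hcp⟩ := mem_filter.1 hp
    obtain ⟨q, -, rfl⟩ := mem_image.1 hc
    refine mem_filter.2 ⟨mem_univ _, ?_⟩
    rw [← hcp]
    generalize p.1 = x
    fin_cases x <;> simp
  have h3 : #(univ.filter fun p : Fin 9 × Bool => p.1 < 4 ∨ p.2 = false) = 13 := by decide
  have h4 := card_le_card h2
  rw [card_cubeFace] at h1
  omega

end ExtendedCube

end ConceptClass

theorem mainTheorem6 :
    -- the inequalities, for every concept class over a finite domain
    (∀ (X : Type*) [Fintype X] [DecidableEq X] (C : Finset (Concept X)),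
      SMN' C ≤ SMN C ∧
      SMN C ≤ GMN C ∧
      GMN C ≤ GMN' C ∧
      GMN' C ≤ min (VCD C) (RTD C) ∧
      SMN' C ≤ AMN' C ∧
      AMN' C ≤ AMN C ∧
      AMN C ≤ STDmin C ∧
      STDmin C ≤ min (VCD C) (RTD C) ∧
      SMN C ≤ AMN C ∧
      AMN' C ≤ GMN' C) ∧
    -- each of them is occasionally strict
    (∃ (n : ℕ) (C : Finset (Concept (Fin n))), SMN' C < SMN C) ∧
    (∃ (n : ℕ) (C : Finset (Concept (Fin n))), SMN C < GMN C) ∧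
    (∃ (n : ℕ) (C : Finset (Concept (Fin n))), GMN C < GMN' C) ∧
    (∃ (n : ℕ) (C : Finset (Concept (Fin n))), GMN' C < min (VCD C) (RTD C)) ∧
    (∃ (n : ℕ) (C : Finset (Concept (Fin n))), SMN' C < AMN' C) ∧
    (∃ (n : ℕ) (C : Finset (Concept (Fin n))), AMN' C < AMN C) ∧
    (∃ (n : ℕ) (C : Finset (Concept (Fin n))), AMN C < STDmin C) ∧
    (∃ (n : ℕ) (C : Finset (Concept (Fin n))), STDmin C < min (VCD C) (RTD C)) ∧
    (∃ (n : ℕ) (C : Finset (Concept (Fin n))), SMN C < AMN C) ∧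
    (∃ (n : ℕ) (C : Finset (Concept (Fin n))), AMN' C < GMN' C) := by
  refine ⟨fun X _ _ C => ⟨SMN'_le_SMN C, SMN_le_GMN C, GMN_le_GMN' C,
    le_min (GMN'_le_VCD C) (GMN'_le_RTD C), SMN'_le_AMN' C, AMN'_le_AMN C, AMN_le_STDmin C,
    le_min (STDmin_le_VCD C) (STDmin_le_RTD C), SMN_le_AMN C, AMN'_le_GMN' C⟩, ?_⟩
  refine ⟨⟨9, extendedCube, ?_⟩, ⟨2, univ, ?_⟩, ⟨6, repeatedPoint, ?_⟩, ⟨3, flatSquare, ?_⟩,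
    ⟨3, puncturedCube, ?_⟩, ⟨9, extendedCube, ?_⟩, ⟨2, univ, ?_⟩, ⟨3, evenParity, ?_⟩,
    ⟨3, puncturedCube, ?_⟩, ⟨2, univ, ?_⟩⟩
  · exact ((SMN'_le_AMN' _).trans AMN'_extendedCube_le).trans_lt two_le_SMN_extendedCube
  · exact ((SMN_le_AMN _).trans AMN_square_le).trans_lt two_le_GMN_square
  · exact GMN_repeatedPoint_le.trans_lt two_le_GMN'_repeatedPoint
  · exact GMN'_flatSquare_le.trans_lt (lt_min two_le_VCD_flatSquare one_lt_RTD_flatSquare)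
  · exact ((SMN'_le_SMN _).trans SMN_puncturedCube_le).trans_lt two_le_AMN'_puncturedCube
  · exact AMN'_extendedCube_le.trans_lt (two_le_SMN_extendedCube.trans (SMN_le_AMN _))
  · exact AMN_square_le.trans_lt (card_le_STDmin_univ (Fin 2))
  · exact STDmin_evenParity_le.trans_lt (lt_min two_le_VCD_evenParity one_lt_RTD_evenParity)
  · exact SMN_puncturedCube_le.trans_lt (two_le_AMN'_puncturedCube.trans (AMN'_le_AMN _))
  · exact ((AMN'_le_AMN _).trans AMN_square_le).trans_lt two_le_GMN'_square
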